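/- For $n\in\mathbb{N}$ and a permutation $\pi=\pi_1\pi_2\cdots\pi_n$ of $[n]=\{1,\dots,n\}$, the pinnacle set of $\pi$ is $\operatorname{Pin}\pi=\{\pi_j \mid 1<j<n,\ \pi_{j-1}<\pi_j>\pi_{j+1}\}$. A finite set $S$ is called admissible if $S=\operatorname{Pin}\pi$ for some permutation $\pi$ of some $[m]$, and $p_S(n)$ denotes the number of permutations $\pi$ of $[n]$ with $\operatorname{Pin}\pi=S$. Let $n\ge 1$ and let $S=\{s_1<s_2<\dots<s_d\}\subseteq[n]$ be admissible (with $d\ge 0$). Put $s_0=0$, $s_{d+1}=n+1$ and $n_i=s_{i+1}-s_i-1$ for $0\le i\le d$. Let $C(d)$ be the set of all sequences $\alpha=[\alpha_1,\dots,\alpha_d]$ with $\alpha_i\in\{0,1,2\}$ for all $i$ and $|\alpha|:=\alpha_1+\dots+\alpha_d\le d$. For $\alpha\in C(d)$ put $$b=|\alpha|,\qquad o=\#\{i \mid \alpha_i=1\},\qquad r_j=\min\{i \mid \alpha_1+\alpha_2+\dots+\alpha_i\ge j\}\quad(1\le j\le b),\qquad b_i=\alpha_i+\alpha_{i+1}+\dots+\alpha_d\quad(1\le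 i\le d+1),$$ so that $b_{d+1}=0$. Then, with the convention $0^0=1$, $$p_S(n)=2^{n-2d-1}\sum_{\alpha\in C(d)}(-1)^{b}\,2^{o}\,(d-b)!\left(\prod_{i=0}^{b-1}\bigl(d+1-i-r_{b-i}\bigr)\right)\left(\prod_{i=0}^{d}\bigl(d+1-i-b_{i+1}\bigr)^{n_i}\right).$$ -/

import Mathlib

open scoped Nat

namespace Pinnacle

/-- The pinnacle set of a permutation `π = π_1 π_2 … π_n` of `[n]`, that is, the set of values `π_j`
with `1 < j < n` and `π_{j-1} < π_j > π_{j+1}`. Positions and values of `Fin n` are `0, …, n-1`,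
so `1` is added to obtain the value in `[n]`. -/
def pin {n : ℕ} (π : Equiv.Perm (Fin n)) : Finset ℕ :=
  (Finset.univ.filter fun j : Fin n =>
    ∃ i k : Fin n, (i : ℕ) + 1 = j ∧ (j : ℕ) + 1 = k ∧ π i < π j ∧ π k < π j).image
      fun j => (π j : ℕ) + 1

/-- `S` is the pinnacle set of some permutation. -/
def IsAdmissible (S : Finset ℕ) : Prop :=
  ∃ (m : ℕ) (π : Equiv.Perm (Fin m)), pin π = S

/-- `p_S(n)`, the number of permutations of `[n]` with pinnacle set `S`. -/
def pinCount (S : Finset ℕ) (n : ℕ) : ℕ :=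
  Finset.card {π : Equiv.Perm (Fin n) | pin π = S}

/-- For `S = {s_1 < ⋯ < s_d} ⊆ [n]` this is `s_i`, with `s_0 = 0` and `s_{d+1} = n + 1`. -/
def elt (S : Finset ℕ) (n i : ℕ) : ℕ :=
  if i = 0 then 0 else (S.sort (· ≤ ·)).getD (i - 1) (n + 1)

/-- `n_i = s_{i+1} - s_i - 1`. -/
def gap (S : Finset ℕ) (n i : ℕ) : ℕ :=
  elt S n (i + 1) - elt S n i - 1

/-- `C(d)`: weak compositions `α = [α_1, …, α_d]` with parts in `{0, 1, 2}` and `|α| ≤ d`;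
the part `α_i` is `α ⟨i - 1, _⟩`. -/
def comps (d : ℕ) : Finset (Fin d → ℕ) :=
  {α ∈ Fintype.piFinset fun _ : Fin d => Finset.range 3 | ∑ k, α k ≤ d}

/-- `o`, the number of parts of `α` equal to `1`. -/
def numOnes {d : ℕ} (α : Fin d → ℕ) : ℕ :=
  Finset.card {k | α k = 1}

/-- For `1 ≤ j ≤ |α|` this is `r_j = min {i ∈ [d] | α_1 + ⋯ + α_i ≥ j}`. -/
noncomputable def rank {d : ℕ} (α : Fin d → ℕ) (j : ℕ) : ℕ :=
  sInf {i : ℕ | 1 ≤ i ∧ i ≤ d ∧ j ≤ ∑ k ∈ Finset.univ.filter (fun k : Fin d => (k : ℕ) + 1 ≤ i), α k}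

/-- `b_i = α_i + α_{i+1} + ⋯ + α_d`. -/
def tailSum {d : ℕ} (α : Fin d → ℕ) (i : ℕ) : ℕ :=
  ∑ k ∈ Finset.univ.filter (fun k : Fin d => i ≤ (k : ℕ) + 1), α k

/-- The term of the sum that belongs to `α`, where `d = #S` and `b = |α|`. -/
noncomputable def summand (S : Finset ℕ) (n : ℕ) {d : ℕ} (α : Fin d → ℕ) : ℤ :=
  let b := ∑ k, α k
  (-1) ^ b * 2 ^ numOnes α * ((d - b)! : ℤ)
    * (∏ i ∈ Finset.range b, ((d : ℤ) + 1 - i - rank α (b - i)))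
    * (∏ i ∈ Finset.range (d + 1), ((d : ℤ) + 1 - i - tailSum α (i + 1)) ^ gap S n i)

end Pinnacle

/-! Build a permutation by inserting 1, 2, …, n in increasing order, keeping a word cut into blocks.
A new maximum enters at a cut: it glues two blocks and becomes a peak, or extends a block at one
end, or forms a block of its own. If B_k counts the words with k blocks, then ∑ B_k x^k / k! is
acted on by x∂² for a value in S and by x + 2x∂ for any other value (`card_blocks_of_mem`,
`card_blocks_of_notMem`). Permutations are the words with one block (`pinCount_eq_card_blocks`).

Multiplication by exp(x/2) replaces ∂ by ∂ - 1/2. The second operator becomes 2x∂, which is diagonal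
on monomials, and the first becomes x(∂² - ∂ + 1/4), which changes the exponent by -1, 0 or 1. So
the coefficient of x is a sum over paths coded by α, one step per element of S, and a gap n_i spent
at level L contributes (2L)^{n_i} (`weight_elt_eq_sum`).

A path starts at level d + 1 - b with weight 1 / (2^(d+1-b) (d+1-b)!). `prod_downFactor` turns the
product of its step weights into factorials times a product over the rising steps, which `prod_rank`
identifies with the rank product. Paths with b > d have weight zero because 1 ∉ S. -/

namespace Pinnacle

/-! ### Words cut into blocks, and insertion of a maximal letter. -/

/-- The entry at position `j` of a word cut into blocks is an interior peak of its block. -/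
def IsPeak {v : ℕ} (σ : Equiv.Perm (Fin v)) (c : Fin (v + 1) → Bool) (j : Fin v) : Prop :=
  c j.castSucc = false ∧ c j.succ = false ∧
    (∀ i : Fin v, (i : ℕ) + 1 = j → σ i < σ j) ∧ ∀ k : Fin v, (j : ℕ) + 1 = k → σ k < σ j

/-- The word `σ`, cut into blocks at the positions marked by `c` (both ends included),
has exactly the values in `S` as interior peaks of blocks. -/
def IsBlocks (S : Finset ℕ) {v : ℕ} (σ : Equiv.Perm (Fin v)) (c : Fin (v + 1) → Bool) : Prop :=
  c 0 = true ∧ c (Fin.last v) = true ∧ ∀ j, IsPeak σ c j ↔ (σ j : ℕ) + 1 ∈ S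

/-- The number of cuts. -/
def numCuts {v : ℕ} (c : Fin v → Bool) : ℕ := ∑ q, (c q).toNat

/-- Insert a new maximal letter at position `p`. -/
def insertMax {v : ℕ} (p : Fin (v + 1)) (σ : Equiv.Perm (Fin v)) : Equiv.Perm (Fin (v + 1)) :=
  (finSuccEquiv' p).trans ((Equiv.optionCongr σ).trans (finSuccEquiv' (Fin.last v)).symm)

/-- Replace the cut mark at `p` by the two marks `x` and `y`. -/
def splitCut {v : ℕ} (p : Fin (v + 1)) (x y : Bool) (c : Fin (v + 1) → Bool) :
    Fin (v + 2) → Bool :=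
  p.castSucc.insertNth (α := fun _ => Bool) x (Function.update c p y)

variable {v : ℕ}

@[simp] lemma insertMax_self (p : Fin (v + 1)) (σ : Equiv.Perm (Fin v)) :
    insertMax p σ p = Fin.last v := by
  simp [insertMax]

@[simp] lemma insertMax_succAbove (p : Fin (v + 1)) (σ : Equiv.Perm (Fin v)) (i : Fin v) :
    insertMax p σ (p.succAbove i) = (σ i).castSucc := by
  simp [insertMax]

lemma exists_insertMax (π : Equiv.Perm (Fin (v + 1))) (p : Fin (v + 1)) (hp : π p = Fin.last v) :
    ∃ σ, insertMax p σ = π := by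
  let e := (finSuccEquiv' p).symm.trans (π.trans (finSuccEquiv' (Fin.last v)))
  have he : e none = none := by simp [e, hp]
  refine ⟨Equiv.removeNone e, ?_⟩
  have h : Equiv.optionCongr (Equiv.removeNone e) = e := by
    refine Equiv.ext fun o => ?_
    cases o with
    | none => simp [he]
    | some a =>
      have ha : e (some a) ≠ none := fun h => by simpa using e.injective (h.trans he.symm)
      exact Equiv.removeNone_some e (Option.ne_none_iff_exists'.1 ha)
  rw [insertMax, h]
  ext i
  simp [e]

lemma insertMax_injective (p : Fin (v + 1)) : Function.Injective (insertMax p) := by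
  intro σ τ h
  ext i
  have := congrArg (fun π => ((π (p.succAbove i) : Fin (v + 1)) : ℕ)) h
  simpa using this

@[simp] lemma splitCut_castSucc (p : Fin (v + 1)) (x y : Bool) (c : Fin (v + 1) → Bool) :
    splitCut p x y c p.castSucc = x := by
  simp [splitCut]

lemma succAbove_castSucc_self (p : Fin (v + 1)) : p.castSucc.succAbove p = p.succ :=
  Fin.succAbove_castSucc_self p

@[simp] lemma splitCut_succ (p : Fin (v + 1)) (x y : Bool) (c : Fin (v + 1) → Bool) :
    splitCut p x y c p.succ = y := by
  rw [← succAbove_castSucc_self, splitCut, Fin.insertNth_apply_succAbove, Function.update_self]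

lemma splitCut_of_lt (p q : Fin (v + 1)) (x y : Bool) (c : Fin (v + 1) → Bool) (h : q < p)
    (r : Fin (v + 2)) (hr : (r : ℕ) = q) : splitCut p x y c r = c q := by
  have : r = p.castSucc.succAbove q := by
    rw [Fin.succAbove_of_castSucc_lt _ _ (by simpa using h)]
    exact Fin.ext hr
  rw [this, splitCut, Fin.insertNth_apply_succAbove, Function.update_of_ne h.ne]

lemma splitCut_of_gt (p q : Fin (v + 1)) (x y : Bool) (c : Fin (v + 1) → Bool) (h : p < q)
    (r : Fin (v + 2)) (hr : (r : ℕ) = q + 1) : splitCut p x y c r = c q := by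
  have : r = p.castSucc.succAbove q := by
    rw [Fin.succAbove_of_lt_succ _ _ (by simpa [Fin.lt_def] using (show (p : ℕ) < q + 1 by
      have := Fin.lt_def.1 h; omega))]
    exact Fin.ext hr
  rw [this, splitCut, Fin.insertNth_apply_succAbove, Function.update_of_ne h.ne']

lemma numCuts_splitCut (p : Fin (v + 1)) (x y : Bool) (c : Fin (v + 1) → Bool) (hc : c p = true) :
    numCuts (splitCut p x y c) + 1 = numCuts c + x.toNat + y.toNat := by
  unfold numCuts
  rw [Fin.sum_univ_succAbove _ p.castSucc, Fin.sum_univ_succAbove _ p,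
    Fin.sum_univ_succAbove (fun q => (c q).toNat) p]
  simp [splitCut, hc]
  omega

lemma exists_splitCut (p : Fin (v + 1)) (c' : Fin (v + 2) → Bool) :
    ∃ c : Fin (v + 1) → Bool, c p = true ∧
      splitCut p (c' p.castSucc) (c' p.succ) c = c' := by
  refine ⟨Function.update (p.castSucc.removeNth c') p true, by simp, ?_⟩
  have : Function.update (Function.update (p.castSucc.removeNth c') p true) p (c' p.succ)
      = p.castSucc.removeNth c' := by
    rw [Function.update_idem, ← succAbove_castSucc_self]
    exact Function.update_eq_self p (p.castSucc.removeNth c')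
  rw [splitCut, this]
  exact Fin.insertNth_self_removeNth _ _

lemma splitCut_injective (p : Fin (v + 1)) (x y : Bool) (c₁ c₂ : Fin (v + 1) → Bool)
    (h₁ : c₁ p = true) (h₂ : c₂ p = true) (h : splitCut p x y c₁ = splitCut p x y c₂) :
    c₁ = c₂ := by
  funext q
  rcases lt_trichotomy q p with hq | rfl | hq
  · rw [← splitCut_of_lt p q x y c₁ hq q.castSucc rfl, h, splitCut_of_lt p q x y c₂ hq q.castSucc rfl]
  · rw [h₁, h₂]
  · rw [← splitCut_of_gt p q x y c₁ hq q.succ rfl, h, splitCut_of_gt p q x y c₂ hq q.succ rfl]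

lemma isPeak_insert_self (p : Fin (v + 1)) (x y : Bool) (σ : Equiv.Perm (Fin v))
    (c : Fin (v + 1) → Bool) :
    IsPeak (insertMax p σ) (splitCut p x y c) p ↔ x = false ∧ y = false := by
  have key : ∀ i, i ≠ p → insertMax p σ i < insertMax p σ p := by
    intro i hi
    rw [insertMax_self]
    refine lt_of_le_of_ne (Fin.le_last _) fun h => hi ?_
    rw [← insertMax_self p σ] at h
    exact (insertMax p σ).injective h
  simp only [IsPeak, splitCut_castSucc, splitCut_succ]
  refine ⟨fun h => ⟨h.1, h.2.1⟩, fun h => ⟨h.1, h.2, fun i hi => key i ?_, fun i hi => key i ?_⟩⟩ <;>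
  · rintro rfl
    omega

lemma val_succAbove (p : Fin (v + 1)) (i : Fin v) :
    (p.succAbove i : ℕ) = if (i : ℕ) < p then (i : ℕ) else i + 1 := by
  split_ifs with h
  · rw [Fin.succAbove_of_castSucc_lt _ _ (Fin.lt_def.2 h)]; rfl
  · rw [Fin.succAbove_of_le_castSucc _ _ (Fin.le_def.2 (not_lt.1 h))]; rfl

lemma forall_lt_insertMax_iff (p : Fin (v + 1)) (σ : Equiv.Perm (Fin v)) (j : Fin v)
    (R : Fin (v + 1) → Prop) (R' : Fin v → Prop) (hp : ¬ R p)
    (hR : ∀ i, R (p.succAbove i) ↔ R' i) :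
    (∀ i, R i → insertMax p σ i < insertMax p σ (p.succAbove j)) ↔ ∀ i, R' i → σ i < σ j := by
  rw [Fin.forall_iff_succAbove p]
  simp [hp, hR]

/-- Only the letters next to the slot could change status. They bordered a cut before and border the
maximum (or a cut) afterwards, so they are peaks neither time. -/
lemma isPeak_insert_succAbove (p : Fin (v + 1)) (x y : Bool) (σ : Equiv.Perm (Fin v))
    (c : Fin (v + 1) → Bool) (hc : c p = true) (j : Fin v) :
    IsPeak (insertMax p σ) (splitCut p x y c) (p.succAbove j) ↔ IsPeak σ c j := by
  have hlast : ¬ (insertMax p σ p < insertMax p σ (p.succAbove j)) := by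
    simp [Fin.le_last]
  have hj := val_succAbove p j
  rcases lt_trichotomy (j + 1 : ℕ) p with h | h | h
  · rw [if_pos (by omega)] at hj
    unfold IsPeak
    rw [splitCut_of_lt p j.castSucc x y c (Fin.lt_def.2 (by simp; omega)) _ (by simp [hj]),
      splitCut_of_lt p j.succ x y c (Fin.lt_def.2 (by simpa using h)) _ (by simp [hj])]
    refine and_congr_right fun _ => and_congr_right fun _ => and_congr
      (forall_lt_insertMax_iff p σ j _ _ (by omega) fun i => ?_)
      (forall_lt_insertMax_iff p σ j _ _ (by omega) fun i => ?_) <;>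
    · rw [hj, val_succAbove]
      split_ifs <;> omega
  · rw [if_pos (by omega)] at hj
    have h2 : j.succ = p := Fin.ext (by simp; omega)
    refine iff_of_false (fun h => hlast (h.2.2.2 p (by omega))) fun h => ?_
    have := h.2.1
    rw [h2, hc] at this
    exact absurd this (by simp)
  rcases eq_or_lt_of_le (Nat.lt_succ_iff.1 h) with h | h
  · rw [if_neg (by omega)] at hj
    have h2 : j.castSucc = p := Fin.ext (by simp; omega)
    refine iff_of_false (fun h => hlast (h.2.2.1 p (by omega))) fun h => ?_
    have := h.1
    rw [h2, hc] at this
    exact absurd this (by simp)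
  · rw [if_neg (by omega)] at hj
    unfold IsPeak
    rw [splitCut_of_gt p j.castSucc x y c (Fin.lt_def.2 h) _ (by simp [hj]),
      splitCut_of_gt p j.succ x y c (Fin.lt_def.2 (by simp; omega)) _ (by simp [hj])]
    refine and_congr_right fun _ => and_congr_right fun _ => and_congr
      (forall_lt_insertMax_iff p σ j _ _ (by omega) fun i => ?_)
      (forall_lt_insertMax_iff p σ j _ _ (by omega) fun i => ?_) <;>
    · rw [hj, val_succAbove]
      split_ifs <;> omega

lemma splitCut_zero (p : Fin (v + 1)) (x y : Bool) (c : Fin (v + 1) → Bool) (hc : c p = true) :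
    splitCut p x y c 0 = true ↔ c 0 = true ∧ (x = false → p ≠ 0) := by
  rcases eq_or_ne p 0 with rfl | hp
  · have := splitCut_castSucc (0 : Fin (v + 1)) x y c
    rw [Fin.castSucc_zero] at this
    simp [this, hc]
  · rw [splitCut_of_lt p 0 x y c (Fin.pos_iff_ne_zero.2 hp) 0 (by simp)]
    simp [hp]

lemma splitCut_last (p : Fin (v + 1)) (x y : Bool) (c : Fin (v + 1) → Bool) (hc : c p = true) :
    splitCut p x y c (Fin.last (v + 1)) = true ↔
      c (Fin.last v) = true ∧ (y = false → p ≠ Fin.last v) := by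
  rcases eq_or_ne p (Fin.last v) with rfl | hp
  · have := splitCut_succ (Fin.last v) x y c
    rw [Fin.succ_last] at this
    simp [this, hc]
  · rw [splitCut_of_gt p (Fin.last v) x y c (Fin.lt_last_iff_ne_last.2 hp) _ (by simp)]
    simp [hp]

/-- An unmarked side of the new letter must have a block to attach to, which excludes the
corresponding end of the word. -/
lemma isBlocks_insert (S : Finset ℕ) (p : Fin (v + 1)) (x y : Bool) (σ : Equiv.Perm (Fin v))
    (c : Fin (v + 1) → Bool) (hc : c p = true) :
    IsBlocks S (insertMax p σ) (splitCut p x y c) ↔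
      IsBlocks S σ c ∧ (x = false → p ≠ 0) ∧ (y = false → p ≠ Fin.last v) ∧
        ((x = false ∧ y = false) ↔ v + 1 ∈ S) := by
  unfold IsBlocks
  rw [splitCut_zero p x y c hc, splitCut_last p x y c hc, Fin.forall_iff_succAbove p,
    isPeak_insert_self]
  simp only [isPeak_insert_succAbove p x y σ c hc, insertMax_self, insertMax_succAbove,
    Fin.val_last, Fin.val_castSucc]
  tauto

/-! ### Recurrences for the number of cut words. -/

open Classical in
/-- The words on `[v]` with `K` cuts (both ends included) whose block peaks are given by `S`. -/
noncomputable def blocks (S : Finset ℕ) (v K : ℕ) :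
    Finset (Equiv.Perm (Fin v) × (Fin (v + 1) → Bool)) :=
  {w | IsBlocks S w.1 w.2 ∧ numCuts w.2 = K}

lemma mem_blocks {S : Finset ℕ} {K : ℕ} {w : Equiv.Perm (Fin v) × (Fin (v + 1) → Bool)} :
    w ∈ blocks S v K ↔ IsBlocks S w.1 w.2 ∧ numCuts w.2 = K := by
  classical
  simp [blocks]

/-- The positions at which the new maximum may be inserted with the marks `x` and `y`. -/
def slots (x y : Bool) (c : Fin (v + 1) → Bool) : Finset (Fin (v + 1)) :=
  {p | c p = true ∧ (x = false → p ≠ 0) ∧ (y = false → p ≠ Fin.last v)}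

lemma card_slots (x y : Bool) (c : Fin (v + 1) → Bool) (h0 : c 0 = true)
    (hl : c (Fin.last v) = true) :
    (slots x y c).card = numCuts c - (!x).toNat - (!y).toNat := by
  have hn : numCuts c = (Finset.univ.filter fun p => c p = true).card := by
    rw [numCuts, Finset.card_filter]
    refine Finset.sum_congr rfl fun q _ => ?_
    cases c q <;> rfl
  have m0 : (0 : Fin (v + 1)) ∈ Finset.univ.filter fun p => c p = true := by simp [h0]
  have ml : Fin.last v ∈ Finset.univ.filter fun p => c p = true := by simp [hl]
  rw [hn]
  cases x <;> cases y
  · have : slots false false c =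
        ((Finset.univ.filter fun p => c p = true).erase 0).erase (Fin.last v) := by
      ext p; simp [slots]; tauto
    rw [this, Finset.card_erase_eq_ite, Finset.card_erase_of_mem m0]
    split_ifs with h
    · rfl
    -- Here the two ends coincide, so the word is empty with a single cut, and truncated subtraction
    -- gives the right value 0.
    · have hv : Fin.last v = 0 := by
        by_contra hne
        exact h (Finset.mem_erase.2 ⟨hne, ml⟩)
      have : v = 0 := by simpa using congrArg Fin.val hv
      subst this
      have : (Finset.univ.filter fun p : Fin (0 + 1) => c p = true).card ≤ 1 := by
        simpa using Finset.card_le_univ (Finset.univ.filter fun p : Fin (0 + 1) => c p = true)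
      simp only [Bool.not_false, Bool.toNat_true]
      omega
  · have : slots false true c = (Finset.univ.filter fun p => c p = true).erase 0 := by
      ext p; simp [slots]; tauto
    rw [this, Finset.card_erase_of_mem m0]; rfl
  · have : slots true false c = (Finset.univ.filter fun p => c p = true).erase (Fin.last v) := by
      ext p; simp [slots]; tauto
    rw [this, Finset.card_erase_of_mem ml]; rfl
  · have : slots true true c = Finset.univ.filter fun p => c p = true := by
      ext p; simp [slots]
    rw [this]; rfl

/-- The part of `blocks S (v + 1) K` where the maximum has the marks `x` and `y`. -/
noncomputable def blocksMax (S : Finset ℕ) (v K : ℕ) (x y : Bool) :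
    Finset (Equiv.Perm (Fin (v + 1)) × (Fin (v + 2) → Bool)) :=
  {w ∈ blocks S (v + 1) K | w.2 (w.1.symm (Fin.last v)).castSucc = x ∧
    w.2 (w.1.symm (Fin.last v)).succ = y}

lemma symm_insertMax_last (p : Fin (v + 1)) (σ : Equiv.Perm (Fin v)) :
    (insertMax p σ).symm (Fin.last v) = p := by
  rw [Equiv.symm_apply_eq, insertMax_self]

/-- Insertion is a bijection from cut words with a chosen slot. One mark is traded for the marks x
and y, whence `hK`. -/
lemma card_blocksMax (S : Finset ℕ) (K K' : ℕ) (x y : Bool) (hK : K + 1 = K' + x.toNat + y.toNat)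
    (hS : (x = false ∧ y = false) ↔ v + 1 ∈ S) :
    (blocksMax S v K x y).card = (blocks S v K').card * (K' - (!x).toNat - (!y).toNat) := by
  have h1 : ((blocks S v K').sigma fun w => slots x y w.2).card =
      (blocks S v K').card * (K' - (!x).toNat - (!y).toNat) := by
    rw [Finset.card_sigma, Finset.sum_const_nat]
    intro w hw
    rw [mem_blocks] at hw
    rw [card_slots x y w.2 hw.1.1 hw.1.2.1, hw.2]
  rw [← h1]
  symm
  refine Finset.card_bij (fun w _ => (insertMax w.2 w.1.1, splitCut w.2 x y w.1.2)) ?_ ?_ ?_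
  · rintro ⟨⟨σ, c⟩, p⟩ h
    simp only [Finset.mem_sigma, mem_blocks, slots, Finset.mem_filter, Finset.mem_univ,
      true_and] at h
    simp only [blocksMax, Finset.mem_filter, mem_blocks, symm_insertMax_last, splitCut_castSucc,
      splitCut_succ, and_true, isBlocks_insert S p x y σ c h.2.1]
    have := numCuts_splitCut p x y c h.2.1
    exact ⟨⟨h.1.1, h.2.2.1, h.2.2.2, hS⟩, by omega⟩
  · rintro ⟨⟨σ, c⟩, p⟩ h ⟨⟨τ, e⟩, q⟩ h' heq
    simp only [Finset.mem_sigma, mem_blocks, slots, Finset.mem_filter, Finset.mem_univ,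
      true_and] at h h'
    simp only [Prod.mk.injEq] at heq
    have hpq : p = q := by
      rw [← symm_insertMax_last p σ, heq.1, symm_insertMax_last]
    subst hpq
    rw [insertMax_injective p heq.1, splitCut_injective p x y c e h.2.1 h'.2.1 heq.2]
  · rintro ⟨π, c'⟩ h
    simp only [blocksMax, Finset.mem_filter, mem_blocks] at h
    obtain ⟨⟨hB, hN⟩, hx, hy⟩ := h
    obtain ⟨σ, hσ⟩ := exists_insertMax π (π.symm (Fin.last v)) (by simp)
    obtain ⟨c, hc, hc'⟩ := exists_splitCut (π.symm (Fin.last v)) c'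
    rw [hx, hy] at hc'
    generalize π.symm (Fin.last v) = p at *
    subst hσ hc'
    rw [isBlocks_insert S p x y σ c hc] at hB
    have := numCuts_splitCut p x y c hc
    refine ⟨⟨⟨σ, c⟩, p⟩, ?_, rfl⟩
    simp only [Finset.mem_sigma, mem_blocks, slots, Finset.mem_filter, Finset.mem_univ, true_and]
    exact ⟨⟨hB.1, by omega⟩, hc, hB.2.1, hB.2.2.1⟩

lemma card_blocks_eq_sum (S : Finset ℕ) (v K : ℕ) :
    (blocks S (v + 1) K).card = ∑ x : Bool, ∑ y : Bool, (blocksMax S v K x y).card := by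
  rw [← Finset.sum_product', Finset.univ_product_univ]
  rw [Finset.card_eq_sum_card_fiberwise (t := Finset.univ)
    (f := fun w => (w.2 (w.1.symm (Fin.last v)).castSucc, w.2 (w.1.symm (Fin.last v)).succ))
    (by simp)]
  refine Finset.sum_congr rfl fun b _ => ?_
  congr 1
  ext w
  simp [blocksMax, Prod.ext_iff]

lemma blocksMax_eq_empty (S : Finset ℕ) (K : ℕ) (x y : Bool)
    (hS : ¬ ((x = false ∧ y = false) ↔ v + 1 ∈ S)) : blocksMax S v K x y = ∅ := by
  rw [Finset.eq_empty_iff_forall_notMem]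
  rintro ⟨π, c'⟩ h
  simp only [blocksMax, Finset.mem_filter, mem_blocks] at h
  obtain ⟨⟨hB, hN⟩, hx, hy⟩ := h
  obtain ⟨σ, hσ⟩ := exists_insertMax π (π.symm (Fin.last v)) (by simp)
  obtain ⟨c, hc, hc'⟩ := exists_splitCut (π.symm (Fin.last v)) c'
  rw [hx, hy] at hc'
  generalize π.symm (Fin.last v) = p at *
  subst hσ hc'
  rw [isBlocks_insert S p x y σ c hc] at hB
  exact hS hB.2.2.2

lemma card_blocks_of_mem (S : Finset ℕ) (k : ℕ) (h : v + 1 ∈ S) :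
    (blocks S (v + 1) (k + 1)).card = (blocks S v (k + 2)).card * k := by
  rw [card_blocks_eq_sum]
  simp only [Fintype.sum_bool]
  rw [blocksMax_eq_empty S _ true true (by simp [h]), blocksMax_eq_empty S _ true false (by simp [h]),
    blocksMax_eq_empty S _ false true (by simp [h]),
    card_blocksMax S (k + 1) (k + 2) false false (by simp) (by simp [h])]
  simp

lemma card_blocks_of_notMem (S : Finset ℕ) (k : ℕ) (h : v + 1 ∉ S) :
    (blocks S (v + 1) (k + 1)).card =
      (blocks S v k).card * k + 2 * ((blocks S v (k + 1)).card * k) := by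
  rw [card_blocks_eq_sum]
  simp only [Fintype.sum_bool]
  rw [blocksMax_eq_empty S _ false false (by simp [h]),
    card_blocksMax S (k + 1) k true true (by simp) (by simp [h]),
    card_blocksMax S (k + 1) (k + 1) true false (by simp) (by simp [h]),
    card_blocksMax S (k + 1) (k + 1) false true (by simp) (by simp [h])]
  simp
  ring

lemma card_blocks_zero (S : Finset ℕ) (k : ℕ) :
    (blocks S 0 (k + 1)).card = if k = 0 then 1 else 0 := by
  have key : ∀ w, w ∈ blocks S 0 (k + 1) ↔ (w.2 = fun _ => true) ∧ k = 0 := by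
    intro w
    rw [mem_blocks]
    constructor
    · rintro ⟨⟨h0, -, -⟩, hn⟩
      refine ⟨funext fun q => by rw [show q = 0 from Fin.ext (by omega)]; exact h0, ?_⟩
      simp [numCuts] at hn
      have : w.2 0 = true := h0
      simp [this] at hn
      exact hn
    · rintro ⟨h, rfl⟩
      simp [IsBlocks, h, numCuts]
  split_ifs with hk
  · rw [Finset.card_eq_one]
    refine ⟨(1, fun _ => true), ?_⟩
    ext w
    rw [key, Finset.mem_singleton, Prod.ext_iff]
    exact ⟨fun h => ⟨Subsingleton.elim _ _, h.1⟩, fun h => ⟨h.2, hk⟩⟩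
  · rw [Finset.card_eq_zero, Finset.eq_empty_iff_forall_notMem]
    intro w hw
    exact hk ((key w).1 hw).2

/-! ### Words with one block are permutations, and their block peaks are pinnacles. -/

/-- The marks of a word consisting of one block. -/
def endCuts (v : ℕ) (q : Fin (v + 1)) : Bool := decide (q = 0 ∨ q = Fin.last v)

lemma numCuts_endCuts (v : ℕ) : numCuts (endCuts (v + 1)) = 2 := by
  rw [numCuts, Fin.sum_univ_succ, Fin.sum_univ_castSucc, Finset.sum_eq_zero]
  · simp [endCuts]
  · intro i _
    have h1 : i.castSucc.succ ≠ Fin.last (v + 1) := by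
      intro h
      have := congrArg Fin.val h
      simp at this
      omega
    simp [endCuts, h1]

lemma eq_endCuts (c : Fin (v + 2) → Bool) (h0 : c 0 = true) (hl : c (Fin.last (v + 1)) = true)
    (hn : numCuts c = 2) : c = endCuts (v + 1) := by
  rw [numCuts, Fin.sum_univ_succ, Fin.sum_univ_castSucc, h0, Fin.succ_last, hl] at hn
  have hz : ∑ i : Fin v, (c i.castSucc.succ).toNat = 0 := by
    simp only [Bool.toNat_true] at hn
    omega
  rw [Finset.sum_eq_zero_iff] at hz
  have hE := numCuts_endCuts v
  rw [numCuts, Fin.sum_univ_succ, Fin.sum_univ_castSucc] at hE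
  have hz' : ∑ i : Fin v, (endCuts (v + 1) i.castSucc.succ).toNat = 0 := by
    have e0 : endCuts (v + 1) 0 = true := by simp [endCuts]
    have el : endCuts (v + 1) (Fin.last v).succ = true := by simp [endCuts]
    rw [e0, el, Bool.toNat_true] at hE
    omega
  rw [Finset.sum_eq_zero_iff] at hz'
  funext q
  refine Fin.cases ?_ (fun q => Fin.lastCases ?_ (fun q => ?_) q) q
  · simp [h0, endCuts]
  · rw [Fin.succ_last, hl]; simp [endCuts]
  · have a := hz q (Finset.mem_univ _)
    have b := hz' q (Finset.mem_univ _)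
    revert a b
    cases c q.castSucc.succ <;> cases endCuts (v + 1) q.castSucc.succ <;> simp

lemma isPeak_endCuts (π : Equiv.Perm (Fin (v + 1))) (j : Fin (v + 1)) :
    IsPeak π (endCuts (v + 1)) j ↔
      ∃ i k : Fin (v + 1), (i : ℕ) + 1 = j ∧ (j : ℕ) + 1 = k ∧ π i < π j ∧ π k < π j := by
  have e1 : endCuts (v + 1) j.castSucc = false ↔ (j : ℕ) ≠ 0 := by
    simp only [endCuts, decide_eq_false_iff_not, not_or, Fin.ext_iff, Fin.val_castSucc,
      Fin.val_zero, Fin.val_last]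
    omega
  have e2 : endCuts (v + 1) j.succ = false ↔ (j : ℕ) ≠ v := by
    simp only [endCuts, decide_eq_false_iff_not, not_or, Fin.ext_iff, Fin.val_succ,
      Fin.val_zero, Fin.val_last]
    omega
  unfold IsPeak
  rw [e1, e2]
  constructor
  · rintro ⟨h1, h2, h3, h4⟩
    exact ⟨⟨j - 1, by omega⟩, ⟨j + 1, by omega⟩, by simp; omega, rfl, h3 _ (by simp; omega), h4 _ rfl⟩
  · rintro ⟨i, k, hi, hk, h3, h4⟩
    refine ⟨by omega, by omega, fun i' hi' => ?_, fun k' hk' => ?_⟩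
    · rwa [show i' = i from Fin.ext (by omega)]
    · rwa [show k' = k from Fin.ext (by omega)]

lemma pin_eq_iff (S : Finset ℕ) (hS : S ⊆ Finset.Icc 1 (v + 1)) (π : Equiv.Perm (Fin (v + 1))) :
    pin π = S ↔ IsBlocks S π (endCuts (v + 1)) := by
  have h0 : endCuts (v + 1) 0 = true := by simp [endCuts]
  have hl : endCuts (v + 1) (Fin.last (v + 1)) = true := by simp [endCuts]
  simp only [IsBlocks, h0, hl, true_and, isPeak_endCuts]
  constructor
  · rintro rfl j
    simp only [pin, Finset.mem_image, Finset.mem_filter, Finset.mem_univ, true_and]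
    constructor
    · intro h; exact ⟨j, h, rfl⟩
    · rintro ⟨j', h, e⟩
      have : j' = j := π.injective (Fin.ext (by omega))
      rwa [this] at h
  · intro h
    ext s
    simp only [pin, Finset.mem_image, Finset.mem_filter, Finset.mem_univ, true_and]
    constructor
    · rintro ⟨j, hj, rfl⟩
      exact (h j).1 hj
    · intro hs
      have := Finset.mem_Icc.1 (hS hs)
      refine ⟨π.symm ⟨s - 1, by omega⟩, (h _).2 ?_, ?_⟩
      · simpa [Nat.sub_add_cancel this.1] using hs
      · simp; omega

theorem pinCount_eq_card_blocks (S : Finset ℕ) (hS : S ⊆ Finset.Icc 1 (v + 1)) :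
    pinCount S (v + 1) = (blocks S (v + 1) 2).card := by
  unfold pinCount
  refine Finset.card_bij (fun π _ => (π, endCuts (v + 1))) ?_ ?_ ?_
  · intro π hπ
    rw [Finset.mem_filter] at hπ
    exact mem_blocks.2 ⟨(pin_eq_iff S hS π).1 hπ.2, numCuts_endCuts v⟩
  · intro π _ τ _ h
    exact (Prod.mk.inj h).1
  · rintro ⟨π, c⟩ h
    rw [mem_blocks] at h
    obtain rfl : c = endCuts (v + 1) := eq_endCuts c h.1.1 h.1.2.1 h.2
    exact ⟨π, Finset.mem_filter.2 ⟨Finset.mem_univ _, (pin_eq_iff S hS π).2 h.1⟩, rfl⟩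

end Pinnacle

namespace Pinnacle

open PowerSeries

variable {v : ℕ}

/-! ### Generating functions and conjugation by exp(x/2). -/

/-- The generating function of words on `[v]` cut into unordered blocks with block peaks given
by `S`, by number of blocks. -/
noncomputable def blockSeries (S : Finset ℕ) (v : ℕ) : ℚ⟦X⟧ :=
  PowerSeries.mk fun k => ((blocks S v (k + 1)).card : ℚ) / k !

lemma blockSeries_zero (S : Finset ℕ) : blockSeries S 0 = 1 := by
  ext k
  rw [blockSeries, coeff_mk, card_blocks_zero, coeff_one]
  split_ifs with h <;> simp [h]

lemma blockSeries_of_mem {S : Finset ℕ} (h : v + 1 ∈ S) :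
    blockSeries S (v + 1) = X * derivative ℚ (derivative ℚ (blockSeries S v)) := by
  ext k
  rw [blockSeries, coeff_mk, card_blocks_of_mem S k h]
  cases k with
  | zero => simp
  | succ k =>
    rw [coeff_succ_X_mul, coeff_derivative, coeff_derivative, blockSeries, coeff_mk]
    simp only [Nat.factorial_succ]
    push_cast
    field_simp

lemma blockSeries_of_notMem {S : Finset ℕ} (h : v + 1 ∉ S) :
    blockSeries S (v + 1) = X * blockSeries S v + C 2 * (X * derivative ℚ (blockSeries S v)) := by
  ext k
  rw [blockSeries, coeff_mk, card_blocks_of_notMem S k h]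
  cases k with
  | zero => simp
  | succ k =>
    rw [map_add, coeff_C_mul, coeff_succ_X_mul, coeff_succ_X_mul, coeff_derivative, blockSeries,
      coeff_mk, coeff_mk]
    simp only [Nat.factorial_succ]
    push_cast
    field_simp

/-- The power series of `exp (x / 2)`. -/
noncomputable def expHalf : ℚ⟦X⟧ := PowerSeries.mk fun k => 1 / (2 ^ k * k !)

lemma derivative_expHalf : derivative ℚ expHalf = C (1 / 2) * expHalf := by
  ext k
  rw [coeff_derivative, coeff_C_mul, expHalf, coeff_mk, coeff_mk, pow_succ, Nat.factorial_succ]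
  push_cast
  field_simp

/-- The generating function of words cut into blocks, multiplied by `exp (x / 2)`. -/
noncomputable def weightSeries (S : Finset ℕ) (v : ℕ) : ℚ⟦X⟧ := expHalf * blockSeries S v

/-- Conjugation turns x + 2x∂ into x + 2x(∂ - 1/2) = 2x∂; the exponent 1/2 is chosen for this
cancellation. -/
lemma weightSeries_of_notMem {S : Finset ℕ} (h : v + 1 ∉ S) :
    weightSeries S (v + 1) = C 2 * (X * derivative ℚ (weightSeries S v)) := by
  have h2 : (C (1 / 2) : ℚ⟦X⟧) * C 2 = 1 := by rw [← map_mul]; norm_num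
  simp only [weightSeries, blockSeries_of_notMem h, Derivation.leibniz, derivative_expHalf,
    smul_eq_mul]
  linear_combination (-(X * expHalf * blockSeries S v)) * h2

lemma weightSeries_of_mem {S : Finset ℕ} (h : v + 1 ∈ S) :
    weightSeries S (v + 1) = X * (derivative ℚ (derivative ℚ (weightSeries S v))
      - derivative ℚ (weightSeries S v) + C (1 / 4) * weightSeries S v) := by
  have h2 : (C (1 / 2) : ℚ⟦X⟧) * 2 = 1 := by
    rw [show (2 : ℚ⟦X⟧) = C 2 from (map_ofNat _ 2).symm, ← map_mul]; norm_num
  have h4 : (C (1 / 4) : ℚ⟦X⟧) = C (1 / 2) * C (1 / 2) := by rw [← map_mul]; norm_num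
  have hC : derivative ℚ (C (1 / 2) : ℚ⟦X⟧) = 0 := derivative_C
  simp only [weightSeries, blockSeries_of_mem h, Derivation.leibniz, derivative_expHalf,
    smul_eq_mul, map_add, h4, hC]
  linear_combination (-(X * expHalf * derivative ℚ (blockSeries S v))
    - X * C (1 / 2) * expHalf * blockSeries S v) * h2

/-- The coefficient of `x ^ k` in `weightSeries S v`, which is zero for negative `k`. -/
noncomputable def weight (S : Finset ℕ) (v : ℕ) (k : ℤ) : ℚ :=
  if k < 0 then 0 else coeff k.toNat (weightSeries S v)

lemma weight_natCast (S : Finset ℕ) (v k : ℕ) : weight S v k = coeff k (weightSeries S v) := by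
  simp [weight]

lemma weight_of_neg (S : Finset ℕ) (v : ℕ) {k : ℤ} (hk : k < 0) : weight S v k = 0 := by
  simp [weight, hk]

lemma weight_zero_of_nonneg (S : Finset ℕ) {k : ℤ} (hk : 0 ≤ k) :
    weight S 0 k = 1 / (2 ^ k.toNat * k.toNat !) := by
  rw [weight, if_neg (not_lt.2 hk), weightSeries, blockSeries_zero, mul_one, expHalf, coeff_mk]

lemma weight_of_notMem {S : Finset ℕ} (h : v + 1 ∉ S) (k : ℤ) :
    weight S (v + 1) k = 2 * k * weight S v k := by
  rcases lt_or_ge k 0 with hk | hk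
  · simp [weight_of_neg _ _ hk]
  · lift k to ℕ using hk
    rw [weight_natCast, weight_natCast, weightSeries_of_notMem h, coeff_C_mul]
    cases k with
    | zero => simp
    | succ k =>
      rw [coeff_succ_X_mul, coeff_derivative]
      push_cast
      ring

lemma weight_of_mem {S : Finset ℕ} (h : v + 1 ∈ S) (k : ℤ) :
    weight S (v + 1) k = (k + 1) * k * weight S v (k + 1) - k * weight S v k
      + 1 / 4 * weight S v (k - 1) := by
  rcases lt_or_ge k 0 with hk | hk
  · rw [weight_of_neg _ _ hk, weight_of_neg _ _ hk, weight_of_neg _ _ (show k - 1 < 0 by omega)]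
    -- At k = -1 the weight at k + 1 = 0 need not vanish, but its coefficient (k + 1)k does.
    rcases eq_or_ne k (-1) with rfl | h1
    · norm_num
    · rw [weight_of_neg _ _ (show k + 1 < 0 by omega)]
      ring
  · lift k to ℕ using hk
    rw [weight_natCast, weight_natCast, weightSeries_of_mem h]
    cases k with
    | zero => simp [weight_of_neg]
    | succ k =>
      rw [show ((k + 1 : ℕ) : ℤ) + 1 = (k + 2 : ℕ) by push_cast; ring,
        show ((k + 1 : ℕ) : ℤ) - 1 = (k : ℕ) by push_cast; ring, weight_natCast, weight_natCast,
        coeff_succ_X_mul, map_add, map_sub, coeff_C_mul, coeff_derivative, coeff_derivative,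
        coeff_derivative]
      push_cast
      ring

theorem pinCount_eq_weight (S : Finset ℕ) (n : ℕ) (hn : 1 ≤ n) (hS : S ⊆ Finset.Icc 1 n) :
    (pinCount S n : ℚ) = weight S n 1 := by
  obtain ⟨v, rfl⟩ := Nat.exists_eq_add_of_le' hn
  -- A nonempty word has at least one block. Hence the factor exp(x/2) does not affect the
  -- coefficient of x.
  have h0 : coeff 0 (blockSeries S (v + 1)) = 0 := by
    by_cases h : v + 1 ∈ S
    · rw [blockSeries_of_mem h, coeff_zero_X_mul]
    · rw [blockSeries_of_notMem h]; simp
  rw [pinCount_eq_card_blocks S hS, show (1 : ℤ) = ((1 : ℕ) : ℤ) from rfl, weight_natCast,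
    weightSeries, coeff_mul, Finset.Nat.antidiagonal_succ]
  simp only [blockSeries, coeff_mk] at h0
  simp at h0
  simp [h0, expHalf, blockSeries]

lemma weight_add_of_forall_notMem {S : Finset ℕ} (s g : ℕ)
    (h : ∀ t, s < t → t ≤ s + g → t ∉ S) (k : ℤ) :
    weight S (s + g) k = (2 * k) ^ g * weight S s k := by
  induction g with
  | zero => simp
  | succ g ih =>
    rw [← add_assoc, weight_of_notMem (h _ (by omega) (by omega)),
      ih fun t h1 h2 => h t h1 (by omega), pow_succ]
    ring

end Pinnacle

namespace Pinnacle

/-! ### The elements of S in order and the gaps between them. -/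

section elements

variable {S : Finset ℕ} {n : ℕ}

lemma elt_zero (S : Finset ℕ) (n : ℕ) : elt S n 0 = 0 := rfl

lemma elt_succ_of_lt {i : ℕ} (hi : i < S.card) :
    elt S n (i + 1) = S.orderEmbOfFin rfl ⟨i, hi⟩ := by
  rw [elt, if_neg (Nat.succ_ne_zero i), Nat.add_sub_cancel, Finset.orderEmbOfFin_apply,
    List.getD_eq_getElem _ _ (by simpa using hi)]
  rfl

lemma elt_card_add_one (S : Finset ℕ) (n : ℕ) : elt S n (S.card + 1) = n + 1 := by
  rw [elt, if_neg (Nat.succ_ne_zero _), Nat.add_sub_cancel, List.getD_eq_default _ _ (by simp)]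

lemma elt_succ_mem {i : ℕ} (hi : i < S.card) : elt S n (i + 1) ∈ S := by
  rw [elt_succ_of_lt hi]
  exact Finset.orderEmbOfFin_mem _ _ _

lemma exists_elt_eq {s : ℕ} (hs : s ∈ S) : ∃ i < S.card, elt S n (i + 1) = s := by
  have : s ∈ Set.range (S.orderEmbOfFin rfl) := by simpa using hs
  obtain ⟨i, hi⟩ := this
  exact ⟨i, i.2, by rw [elt_succ_of_lt i.2, ← hi]⟩

lemma elt_lt_succ (hS : S ⊆ Finset.Icc 1 n) {i : ℕ} (hi : i ≤ S.card) :
    elt S n i < elt S n (i + 1) := by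
  rcases hi.lt_or_eq with h | rfl
  · have h1 := Finset.mem_Icc.1 (hS (elt_succ_mem (n := n) h))
    cases i with
    | zero => rw [elt_zero]; omega
    | succ i =>
      rw [elt_succ_of_lt h, elt_succ_of_lt (i.lt_succ_self.trans h)]
      exact (S.orderEmbOfFin rfl).strictMono (Fin.lt_def.2 (Nat.lt_succ_self _))
  · rw [elt_card_add_one]
    rcases Nat.eq_zero_or_pos S.card with h | h
    · rw [h, elt_zero]; omega
    · obtain ⟨j, hj : S.card = j + 1⟩ := Nat.exists_eq_add_of_le' h
      have := Finset.mem_Icc.1 (hS (elt_succ_mem (n := n) (show j < S.card by omega)))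
      rw [hj]
      omega

lemma elt_lt_elt (hS : S ⊆ Finset.Icc 1 n) {i j : ℕ} (hij : i < j) (hj : j ≤ S.card + 1) :
    elt S n i < elt S n j := by
  induction j, hij using Nat.le_induction with
  | base => exact elt_lt_succ hS (by omega)
  | succ j _ ih => exact (ih (by omega)).trans (elt_lt_succ hS (by omega))

lemma notMem_of_elt_lt (hS : S ⊆ Finset.Icc 1 n) {i t : ℕ} (hi : i ≤ S.card)
    (h1 : elt S n i < t) (h2 : t < elt S n (i + 1)) : t ∉ S := by
  intro ht
  obtain ⟨j, hj, rfl⟩ := exists_elt_eq (n := n) ht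
  rcases lt_trichotomy (j + 1) i with h | h | h
  · have := elt_lt_elt hS h (by omega); omega
  · rw [h] at h1; omega
  · rcases eq_or_lt_of_le (Nat.lt_succ_iff.1 h) with rfl | h
    · omega
    · have := elt_lt_elt hS (show i + 1 < j + 1 by omega) (by omega); omega

lemma elt_add_gap (hS : S ⊆ Finset.Icc 1 n) {i : ℕ} (hi : i ≤ S.card) :
    elt S n i + gap S n i + 1 = elt S n (i + 1) := by
  have := elt_lt_succ hS hi
  rw [gap]
  omega

lemma sum_gap (hS : S ⊆ Finset.Icc 1 n) :
    ∑ i ∈ Finset.range (S.card + 1), gap S n i + S.card = n := by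
  have key : ∀ i ≤ S.card + 1, ∑ j ∈ Finset.range i, gap S n j + i = elt S n i := by
    intro i
    induction i with
    | zero => intro; simp [elt_zero]
    | succ i ih =>
      intro hi
      rw [Finset.sum_range_succ, ← elt_add_gap hS (by omega), ← ih (by omega)]
      ring
  have := key _ le_rfl
  rw [elt_card_add_one] at this
  omega

end elements

/-! ### Expansion into weighted paths. -/

/-- The weight of a step of size `x` upwards, taken at level `L`. -/
def step (x : ℕ) (L : ℤ) : ℚ := if x = 0 then L * (L - 1) else if x = 1 then -L else 1 / 4

/-- The level at time `j` of the path which ends at level `k` at time `i` and has the steps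
`a 0 - 1, a 1 - 1, …`. -/
def level (a : ℕ → ℕ) (i : ℕ) (k : ℤ) (j : ℕ) : ℤ :=
  k + (i - j) - ∑ t ∈ Finset.Ico j i, (a t : ℤ)

/-- The weight of a path. -/
noncomputable def pathWeight (S : Finset ℕ) (n i : ℕ) (k : ℤ) (a : ℕ → ℕ) : ℚ :=
  weight S 0 (level a i k 0) *
    ∏ j ∈ Finset.range i, (step (a j) (level a i k j) * (2 * (level a i k j : ℚ)) ^ gap S n j)

/-- Extension of a finite sequence by zero. -/
def extend {d : ℕ} (α : Fin d → ℕ) (t : ℕ) : ℕ := if h : t < d then α ⟨t, h⟩ else 0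

lemma extend_snoc_last {i : ℕ} (α : Fin i → ℕ) (x : ℕ) :
    extend (Fin.snoc (α := fun _ => ℕ) α x : Fin (i + 1) → ℕ) i = x := by
  have : (⟨i, i.lt_succ_self⟩ : Fin (i + 1)) = Fin.last i := rfl
  rw [extend, dif_pos i.lt_succ_self, this, Fin.snoc_last]

lemma extend_snoc_of_lt {i : ℕ} (α : Fin i → ℕ) (x : ℕ) {t : ℕ} (ht : t < i) :
    extend (Fin.snoc (α := fun _ => ℕ) α x : Fin (i + 1) → ℕ) t = extend α t := by
  have : (⟨t, by omega⟩ : Fin (i + 1)) = Fin.castSucc ⟨t, ht⟩ := rfl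
  rw [extend, dif_pos (by omega), this, Fin.snoc_castSucc, extend, dif_pos ht]

lemma level_snoc {i : ℕ} (α : Fin i → ℕ) (x : ℕ) (k : ℤ) {j : ℕ} (hj : j ≤ i) :
    level (extend (Fin.snoc (α := fun _ => ℕ) α x : Fin (i + 1) → ℕ)) (i + 1) k j =
      level (extend α) i (k + 1 - x) j := by
  rw [level, level, Finset.sum_Ico_succ_top hj, extend_snoc_last,
    Finset.sum_congr rfl fun t ht => by rw [extend_snoc_of_lt α x (Finset.mem_Ico.1 ht).2]]
  push_cast
  ring

lemma pathWeight_snoc (S : Finset ℕ) (n : ℕ) {i : ℕ} (α : Fin i → ℕ) (x : ℕ) (k : ℤ) :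
    pathWeight S n (i + 1) k (extend (Fin.snoc (α := fun _ => ℕ) α x : Fin (i + 1) → ℕ)) =
      step x (k + 1 - x) * (2 * ((k + 1 - x : ℤ) : ℚ)) ^ gap S n i *
        pathWeight S n i (k + 1 - x) (extend α) := by
  have hi : level (extend α) i (k + 1 - x) i = k + 1 - x := by simp [level]
  rw [pathWeight, Finset.prod_range_succ, level_snoc α x k le_rfl, level_snoc α x k (Nat.zero_le _),
    extend_snoc_last, hi, pathWeight, Finset.prod_congr rfl fun j hj => by
      rw [level_snoc α x k (Finset.mem_range.1 hj).le, extend_snoc_of_lt α x (Finset.mem_range.1 hj)]]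
  ring

lemma sum_piFinset_snoc {M : Type*} [AddCommMonoid M] (i : ℕ) (s : Finset ℕ)
    (f : (Fin (i + 1) → ℕ) → M) :
    ∑ α ∈ Fintype.piFinset fun _ : Fin (i + 1) => s, f α =
      ∑ x ∈ s, ∑ α ∈ Fintype.piFinset fun _ : Fin i => s, f (Fin.snoc (α := fun _ => ℕ) α x) := by
  rw [← Finset.sum_product']
  refine Finset.sum_nbij' (fun α => (α (Fin.last i), Fin.init α))
    (fun w => Fin.snoc (α := fun _ => ℕ) w.2 w.1) ?_ ?_ ?_ ?_ ?_
  · intro α h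
    rw [Fintype.mem_piFinset] at h
    simp [h, Fin.init]
  · rintro ⟨x, α⟩ h
    simp only [Finset.mem_product, Fintype.mem_piFinset] at h ⊢
    intro j
    refine Fin.lastCases ?_ (fun j => ?_) j
    · simpa using h.1
    · simpa using h.2 j
  · intro α _; simp
  · intro w _; simp
  · intro α _; simp

/-- Iterate the three-term recurrence `weight_of_mem`, peeling off the last step: a part x leads to
level k from level k + 1 - x. Within a gap the level is constant. -/
theorem weight_elt_eq_sum {S : Finset ℕ} {n : ℕ} (hS : S ⊆ Finset.Icc 1 n) {i : ℕ}
    (hi : i ≤ S.card) (k : ℤ) :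
    weight S (elt S n i) k =
      ∑ α ∈ Fintype.piFinset fun _ : Fin i => Finset.range 3, pathWeight S n i k (extend α) := by
  induction i generalizing k with
  | zero => simp [elt_zero, pathWeight, level]
  | succ i ih =>
    have hw : ∀ z, weight S (elt S n i + gap S n i) z =
        (2 * z) ^ gap S n i * weight S (elt S n i) z :=
      weight_add_of_forall_notMem _ _ fun t h1 h2 =>
        notMem_of_elt_lt hS (by omega) h1 (by rw [← elt_add_gap hS (by omega)]; omega)
    have hm : elt S n i + gap S n i + 1 ∈ S := by
      rw [elt_add_gap hS (by omega)]
      exact elt_succ_mem (by omega)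
    rw [← elt_add_gap hS (by omega), weight_of_mem hm, sum_piFinset_snoc]
    simp only [pathWeight_snoc, ← Finset.mul_sum, ← ih (by omega : i ≤ S.card), hw]
    simp only [Finset.sum_range_succ, Finset.sum_range_zero, step]
    norm_num
    rw [show k + 1 - 2 = k - 1 by ring]
    ring

theorem pinCount_eq_sum_pathWeight (S : Finset ℕ) (n : ℕ) (hn : 1 ≤ n) (hS : S ⊆ Finset.Icc 1 n) :
    (pinCount S n : ℚ) = 2 ^ gap S n S.card *
      ∑ α ∈ Fintype.piFinset fun _ : Fin S.card => Finset.range 3,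
        pathWeight S n S.card 1 (extend α) := by
  have h := elt_add_gap hS le_rfl
  rw [elt_card_add_one] at h
  rw [pinCount_eq_weight S n hn hS, ← weight_elt_eq_sum hS le_rfl,
    show n = elt S n S.card + gap S n S.card by omega,
    weight_add_of_forall_notMem _ _ fun t h1 h2 =>
        notMem_of_elt_lt hS le_rfl h1 (by rw [elt_card_add_one]; omega)]
  rw [show elt S n S.card + gap S n S.card = n by omega]
  norm_num

end Pinnacle

namespace Pinnacle

/-! ### Levels, ranks and the rank product. -/

lemma prod_range_sum {M : Type*} [CommMonoid M] (a : ℕ → ℕ) (f : ℕ → M) (m : ℕ) :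
    ∏ j ∈ Finset.range (∑ t ∈ Finset.range m, a t), f j =
      ∏ t ∈ Finset.range m, ∏ j ∈ Finset.range (a t), f (∑ s ∈ Finset.range t, a s + j) := by
  induction m with
  | zero => simp
  | succ m ih => rw [Finset.sum_range_succ, Finset.prod_range_add, ih, Finset.prod_range_succ]

section sequences

variable {d : ℕ} (α : Fin d → ℕ)

@[simp] lemma extend_val (k : Fin d) : extend α k = α k := by simp [extend]

lemma sum_filter_eq_sum_extend (P : ℕ → Prop) [DecidablePred P] :
    ∑ k ∈ Finset.univ.filter (fun k : Fin d => P k), α k =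
      ∑ t ∈ (Finset.range d).filter P, extend α t := by
  rw [Finset.sum_filter, Finset.sum_filter, Finset.sum_range]
  simp

lemma sum_eq_sum_extend : ∑ k, α k = ∑ t ∈ Finset.range d, extend α t := by
  rw [Finset.sum_range]
  simp

lemma sum_filter_le_eq {i : ℕ} (hi : i ≤ d) :
    ∑ k ∈ Finset.univ.filter (fun k : Fin d => (k : ℕ) + 1 ≤ i), α k =
      ∑ t ∈ Finset.range i, extend α t := by
  rw [sum_filter_eq_sum_extend α fun t => t + 1 ≤ i]
  refine Finset.sum_congr ?_ fun _ _ => rfl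
  ext t
  simp only [Finset.mem_filter, Finset.mem_range]
  omega

lemma level_one_eq_tailSum (j : ℕ) :
    level (extend α) d 1 j = (d : ℤ) + 1 - j - tailSum α (j + 1) := by
  have : tailSum α (j + 1) = ∑ t ∈ Finset.Ico j d, extend α t := by
    rw [tailSum, sum_filter_eq_sum_extend α fun t => j + 1 ≤ t + 1]
    refine Finset.sum_congr ?_ fun _ _ => rfl
    ext t
    simp only [Finset.mem_filter, Finset.mem_range, Finset.mem_Ico]
    omega
  rw [level, this]
  push_cast
  ring

lemma level_one_eq_sum_range {j : ℕ} (hj : j ≤ d) :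
    level (extend α) d 1 j =
      (d : ℤ) + 1 - j - ∑ k, (α k : ℤ) + ∑ t ∈ Finset.range j, (extend α t : ℤ) := by
  have h1 : ∑ k, (α k : ℤ) = ∑ t ∈ Finset.range d, (extend α t : ℤ) := by
    exact_mod_cast sum_eq_sum_extend α
  rw [level, h1, ← Finset.sum_range_add_sum_Ico _ hj]
  ring

lemma level_one_succ {j : ℕ} (hj : j < d) :
    level (extend α) d 1 (j + 1) = level (extend α) d 1 j - 1 + extend α j := by
  rw [level_one_eq_sum_range α hj, level_one_eq_sum_range α hj.le, Finset.sum_range_succ]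
  push_cast
  ring

lemma rank_eq {t i : ℕ} (ht : t < d) (h1 : ∑ s ∈ Finset.range t, extend α s ≤ i)
    (h2 : i < ∑ s ∈ Finset.range (t + 1), extend α s) : rank α (i + 1) = t + 1 := by
  refine IsLeast.csInf_eq ⟨⟨by omega, ht, ?_⟩, ?_⟩
  · rw [sum_filter_le_eq α ht]
    exact h2
  · rintro r ⟨-, hr, h⟩
    rw [sum_filter_le_eq α hr] at h
    by_contra hlt
    have : ∑ s ∈ Finset.range r, extend α s ≤ ∑ s ∈ Finset.range t, extend α s :=
      Finset.sum_le_sum_of_subset (Finset.range_subset_range.2 (by omega))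
    omega

/-- The factor of the rank product that comes from a part `x` at level `L`. -/
def upFactor (x : ℕ) (L : ℤ) : ℤ := if x = 0 then 1 else if x = 1 then L else L * (L + 1)

/-- The factor, up to sign and powers of two, of the weight of a step `x` at level `L`. -/
def downFactor (x : ℕ) (L : ℤ) : ℤ := if x = 0 then L * (L - 1) else if x = 1 then L else 1

/-- The b units of α are grouped by the part containing them. The j-th unit (from 0) of a part that
acts at level L contributes L + j. -/
lemma prod_rank (hα : ∀ t, extend α t < 3) :
    ∏ i ∈ Finset.range (∑ k, α k), ((d : ℤ) + 1 - i - rank α (∑ k, α k - i)) =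
      ∏ j ∈ Finset.range d, upFactor (extend α j) (level (extend α) d 1 j) := by
  have hb := sum_eq_sum_extend α
  -- Reversal replaces r_{b-i} by r_{i+1}, so the units are met in the order of the parts.
  rw [← Finset.prod_range_reflect]
  have e : ∀ i ∈ Finset.range (∑ k, α k),
      ((d : ℤ) + 1 - ((∑ k, α k - 1 - i : ℕ) : ℤ) - rank α (∑ k, α k - (∑ k, α k - 1 - i))) =
        (d : ℤ) + 2 - ∑ k, (α k : ℤ) + i - rank α (i + 1) := by
    intro i hi
    rw [Finset.mem_range] at hi
    rw [show ∑ k, α k - (∑ k, α k - 1 - i) = i + 1 by omega,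
      show ∑ k, α k - 1 - i = ∑ k, α k - (i + 1) by omega, Nat.cast_sub hi]
    push_cast
    ring
  rw [Finset.prod_congr rfl e, hb, prod_range_sum]
  refine Finset.prod_congr rfl fun t ht => ?_
  rw [Finset.mem_range] at ht
  have e2 : ∀ j ∈ Finset.range (extend α t),
      ((d : ℤ) + 2 - ∑ k, (α k : ℤ) + ((∑ s ∈ Finset.range t, extend α s + j : ℕ) : ℤ) -
        rank α (∑ s ∈ Finset.range t, extend α s + j + 1)) = level (extend α) d 1 t + j := by
    intro j hj
    rw [Finset.mem_range] at hj
    rw [rank_eq α ht (by omega) (by rw [Finset.sum_range_succ]; omega),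
      level_one_eq_sum_range α ht.le]
    push_cast
    ring
  rw [Finset.prod_congr rfl e2]
  have h3 := hα t
  generalize extend α t = x at *
  interval_cases x <;> simp [Finset.prod_range_succ, upFactor]

end sequences

/-! ### Evaluation of the path weights. -/

/-- Telescoping of L! (L - 1)!: a step down divides it by L(L - 1), a step up multiplies it by L(L +
1), and a level step puts L on both sides. Paths that leave the positive levels cause no trouble:
descending from 1 costs the factor L(L - 1) = 0, and returning from 0 gives L(L + 1) = 0 on the
other side. -/
lemma prod_downFactor (a : ℕ → ℕ) (ℓ : ℕ → ℤ) (d : ℕ) (ha : ∀ j, a j < 3)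
    (hl : ∀ j < d, ℓ (j + 1) = ℓ j - 1 + a j) (m₀ : ℕ) (h0 : ℓ 0 = m₀ + 1) :
    ∀ i ≤ d, (ℓ i ≤ 0 → ∏ j ∈ Finset.range i, downFactor (a j) (ℓ j) = 0) ∧
      ∀ m : ℕ, ℓ i = m + 1 →
        (∏ j ∈ Finset.range i, downFactor (a j) (ℓ j)) * ((m + 1)! * m !) =
          (m₀ + 1)! * m₀ ! * ∏ j ∈ Finset.range i, upFactor (a j) (ℓ j) := by
  intro i
  induction i with
  | zero =>
    refine fun _ => ⟨fun h => by omega, fun m hm => ?_⟩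
    obtain rfl : m = m₀ := by omega
    simp
  | succ i ih =>
    intro hi
    obtain ⟨ih1, ih2⟩ := ih (by omega)
    have hs := hl i hi
    have hx := ha i
    rw [Finset.prod_range_succ, Finset.prod_range_succ]
    generalize a i = x at *
    generalize (∏ j ∈ Finset.range i, downFactor (a j) (ℓ j)) = D at *
    generalize (∏ j ∈ Finset.range i, upFactor (a j) (ℓ j)) = U at *
    rcases le_or_gt (ℓ i) 0 with h | h
    · refine ⟨fun _ => by rw [ih1 h, zero_mul], fun m hm => ?_⟩
      rw [ih1 h]
      -- A step raises the level by at most 1, so the path can become positive only from level 0,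
      -- with x = 2.
      have hz : ℓ i = 0 := by omega
      obtain rfl : x = 2 := by omega
      simp [hz, upFactor]
    · obtain ⟨m, hm⟩ := Int.eq_ofNat_of_zero_le (show 0 ≤ ℓ i - 1 by omega)
      have hm' : ℓ i = m + 1 := by omega
      have ih3 := ih2 m hm'
      constructor
      · intro h'
        obtain rfl : x = 0 := by omega
        obtain rfl : m = 0 := by omega
        simp [hm', downFactor]
      · intro m' h'
        rw [hm']
        interval_cases x
        · obtain rfl : m = m' + 1 := by omega
          simp only [downFactor, upFactor, if_true]
          rw [Nat.factorial_succ (m' + 1)] at ih3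
          rw [Nat.factorial_succ] at ih3 ⊢
          push_cast at ih3 ⊢
          linear_combination ih3
        · obtain rfl : m = m' := by omega
          simp only [downFactor, upFactor, one_ne_zero, if_true, if_false]
          linear_combination ((m : ℤ) + 1) * ih3
        · obtain rfl : m' = m + 1 := by omega
          simp only [downFactor, upFactor, OfNat.ofNat_ne_zero, OfNat.ofNat_ne_one, if_false]
          rw [Nat.factorial_succ (m + 1)]
          rw [Nat.factorial_succ m] at ih3 ⊢
          push_cast at ih3 ⊢
          linear_combination ((m : ℤ) + 1) * (m + 2) * ih3

/-- Writing the constants as (-1)^x 2^[x=1] / 2^x makes their product (-1)^b 2^o / 2^b. -/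
lemma step_eq {x : ℕ} (hx : x < 3) (L : ℤ) :
    step x L = downFactor x L * ((-1) ^ x * 2 ^ (if x = 1 then 1 else 0) / 2 ^ x) := by
  interval_cases x <;> norm_num [step, downFactor]

lemma one_notMem_of_isAdmissible {S : Finset ℕ} (hS : IsAdmissible S) : 1 ∉ S := by
  obtain ⟨m, π, rfl⟩ := hS
  simp only [pin, Finset.mem_image, Finset.mem_filter, Finset.mem_univ, true_and, not_exists,
    not_and]
  rintro j ⟨i, k, -, -, h, -⟩ h1
  have := Fin.lt_def.1 h
  omega

lemma gap_zero_pos {S : Finset ℕ} {n : ℕ} (hn : 1 ≤ n) (hS : S ⊆ Finset.Icc 1 n) (h1 : 1 ∉ S) :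
    0 < gap S n 0 := by
  have h := elt_add_gap hS (Nat.zero_le _)
  rw [elt_zero] at h
  rcases Nat.eq_zero_or_pos S.card with h0 | h0
  · have := elt_card_add_one S n
    rw [h0] at this
    omega
  · have hm := elt_succ_mem (n := n) h0
    have : elt S n (0 + 1) ≠ 1 := fun h => h1 (h ▸ hm)
    omega

/-- The initial level d + 1 - b is at most 0. If negative, the initial weight vanishes; if zero, the
factor 0^{n_0} does, since 1 ∉ S forces n_0 > 0. -/
lemma pathWeight_eq_zero {S : Finset ℕ} {n : ℕ} (hn : 1 ≤ n) (hS : S ⊆ Finset.Icc 1 n)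
    (h1 : 1 ∉ S) (α : Fin S.card → ℕ) (hα : S.card < ∑ k, α k) :
    pathWeight S n S.card 1 (extend α) = 0 := by
  have h0 := level_one_eq_sum_range α (Nat.zero_le _)
  have hα' : (S.card : ℤ) < ∑ k, (α k : ℤ) := by exact_mod_cast hα
  simp only [Finset.range_zero, Finset.sum_empty] at h0
  rcases lt_or_ge (level (extend α) S.card 1 0) 0 with h | h
  · rw [pathWeight, weight_of_neg _ _ h, zero_mul]
  · have hz : level (extend α) S.card 1 0 = 0 := by push_cast at h0; omega
    have hd : 0 < S.card := by
      rcases Nat.eq_zero_or_pos S.card with hd | hd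
      · have : IsEmpty (Fin S.card) := by rw [hd]; infer_instance
        simp at hα
      · exact hd
    rw [pathWeight, Finset.prod_eq_zero (Finset.mem_range.2 hd), mul_zero]
    rw [hz]
    simp [(gap_zero_pos hn hS h1).ne']

lemma pathWeight_eq_summand {S : Finset ℕ} {n : ℕ} (hS : S ⊆ Finset.Icc 1 n)
    (α : Fin S.card → ℕ) (hα : ∀ k, α k < 3) (hb : ∑ k, α k ≤ S.card) :
    (2 : ℚ) ^ gap S n S.card * pathWeight S n S.card 1 (extend α) =
      (2 : ℚ) ^ ((n : ℤ) - 2 * S.card - 1) * (summand S n α : ℤ) := by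
  have ha : ∀ t, extend α t < 3 := by
    intro t
    rw [extend]
    split_ifs with h
    · exact hα _
    · norm_num
  obtain ⟨m, hm⟩ := Nat.exists_eq_add_of_le hb
  have h0 : level (extend α) S.card 1 0 = m + 1 := by
    have h0 := level_one_eq_sum_range α (Nat.zero_le _)
    have hm' : (S.card : ℤ) = ∑ k, (α k : ℤ) + m := by exact_mod_cast hm
    simp only [Finset.range_zero, Finset.sum_empty] at h0
    push_cast at h0
    omega
  have hlast : level (extend α) S.card 1 S.card = 1 := by simp [level]
  -- The path ends at level 1, where L! (L - 1)! = 1, so the step factors equal (m + 1)! m! times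
  -- the rank product. The initial weight cancels (m + 1)!, leaving m! = (d - b)!.
  have key := (prod_downFactor (extend α) (level (extend α) S.card 1) S.card ha
    (fun j hj => level_one_succ α hj) m h0 S.card le_rfl).2 0 (by rw [hlast]; rfl)
  have hrank := prod_rank α ha
  have hw : weight S 0 (level (extend α) S.card 1 0) = 1 / (2 ^ (m + 1) * (m + 1)!) := by
    rw [h0, weight_zero_of_nonneg S (by omega)]
    rfl
  have hones : numOnes α = ∑ t ∈ Finset.range S.card, if extend α t = 1 then 1 else 0 := by
    rw [numOnes, Finset.card_filter, Finset.sum_range]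
    simp
  have hgap := sum_gap hS
  rw [Finset.sum_range_succ] at hgap
  -- The gaps give 2^(n-d), the initial weight 2^(-(m+1)) and the steps 2^(-b), where m + b = d.
  have h2 : (2 : ℚ) ^ ((n : ℤ) - 2 * S.card - 1) =
      2 ^ (∑ j ∈ Finset.range S.card, gap S n j) * 2 ^ gap S n S.card /
        (2 ^ (m + 1) * 2 ^ ∑ k, α k) := by
    rw [← pow_add, ← pow_add, ← zpow_natCast, ← zpow_natCast, ← zpow_sub₀ two_ne_zero]
    congr 1
    have e1 : (n : ℤ) = ((∑ j ∈ Finset.range S.card, gap S n j + gap S n S.card : ℕ) : ℤ)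
        + S.card := by exact_mod_cast hgap.symm
    have e2 : (S.card : ℤ) = ((∑ k, α k : ℕ) : ℤ) + m := by exact_mod_cast hm
    rw [e1, Nat.cast_add (m + 1), Nat.cast_add m, Nat.cast_one]
    omega
  simp only [summand]
  rw [hrank, show S.card - ∑ k, α k = m by omega]
  simp only [← level_one_eq_tailSum α]
  rw [Finset.prod_range_succ _ S.card, hlast, one_pow, mul_one]
  have hstep : ∏ j ∈ Finset.range S.card, (step (extend α j) (level (extend α) S.card 1 j) *
        (2 * (level (extend α) S.card 1 j : ℚ)) ^ gap S n j) =
      ((∏ j ∈ Finset.range S.card, downFactor (extend α j) (level (extend α) S.card 1 j) : ℤ) : ℚ)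
        * ((-1) ^ (∑ k, α k) * 2 ^ numOnes α / 2 ^ ∑ k, α k) *
        (2 ^ (∑ j ∈ Finset.range S.card, gap S n j) *
          ((∏ j ∈ Finset.range S.card, level (extend α) S.card 1 j ^ gap S n j : ℤ) : ℚ)) := by
    rw [Finset.prod_mul_distrib, hones, sum_eq_sum_extend, ← Finset.prod_pow_eq_pow_sum,
      ← Finset.prod_pow_eq_pow_sum, ← Finset.prod_pow_eq_pow_sum, ← Finset.prod_pow_eq_pow_sum]
    push_cast
    congr 1
    · rw [← Finset.prod_mul_distrib, ← Finset.prod_div_distrib, ← Finset.prod_mul_distrib]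
      exact Finset.prod_congr rfl fun j _ => step_eq (ha j) _
    · rw [← Finset.prod_mul_distrib]
      exact Finset.prod_congr rfl fun j _ => mul_pow _ _ _
  rw [pathWeight, hw, hstep, h2]
  simp only [Nat.factorial, Nat.cast_one, mul_one] at key
  rw [key]
  have hf : ((m + 1)! : ℚ) ≠ 0 := by positivity
  rw [← Nat.factorial_succ]
  push_cast
  field_simp

end Pinnacle

theorem mainTheorem7 (n d : ℕ) (hn : 1 ≤ n) (S : Finset ℕ) (hS : Pinnacle.IsAdmissible S)
    (hSn : S ⊆ Finset.Icc 1 n) (hd : S.card = d) :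
    (Pinnacle.pinCount S n : ℚ) =
      (2 : ℚ) ^ ((n : ℤ) - 2 * d - 1) *
        ((∑ α ∈ Pinnacle.comps d, Pinnacle.summand S n α : ℤ) : ℚ) := by
  subst hd
  rw [Pinnacle.pinCount_eq_sum_pathWeight S n hn hSn, Finset.mul_sum, Int.cast_sum, Finset.mul_sum,
    Pinnacle.comps, Finset.sum_filter]
  refine Finset.sum_congr rfl fun α hα => ?_
  simp only [Fintype.mem_piFinset, Finset.mem_range] at hα
  split_ifs with h
  · exact Pinnacle.pathWeight_eq_summand hSn α hα h
  · rw [Pinnacle.pathWeight_eq_zero hn hSn (Pinnacle.one_notMem_of_isAdmissible hS) α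
      (not_le.1 h), mul_zero]
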